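/- Fix $p\in\mathbb N$. For each sample size $n$ let $X=X_n\in\mathbb R^{n\times p}$ be a deterministic design matrix with rows $x_1,\dots,x_n$, such that $$C_n:=\tfrac1n X^\top X\to C\succ O,\qquad \tfrac1n\max_{i}\|x_i\|_2^2\to 0\qquad(n\to\infty),$$ and let $y=X\beta^*+\varepsilon$, where $\beta^*\in\mathbb R^p$ is the fixed true parameter and $\varepsilon\in\mathbb R^n$ has i.i.d. $\mathcal N(0,\sigma^2)$ entries. Let $\tilde\beta\in\mathbb R^p$ be a fixed (deterministic) source parameter, and let $\lambda_n,\eta_n$ be real sequences of regularization parameters. Let $\hat\beta=\hat\beta_n$ be a Transfer Lasso estimator, i.e. a (measurable) random vector with $$\hat\beta_n\in\operatorname*{argmin}_{\beta\in\mathbb R^p}\Big\{\tfrac1n\|y-X\beta\|_2^2+\tfrac{\lambda_n}{n}\sum_{j=1}^p|\beta_j|+\tfrac{\eta_n}{n}\sum_{j=1}^p|\beta_j-\tilde\beta_j|\Big\}.$$ Put $$S:=\{j:\beta^*_j\ne0\},\quad T:=\{j:\tilde\beta_j\ne\beta^*_j\},\quad \hat S_n:=\{j:\hat\beta_j\neq0\},\quad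 \hat T_n:=\{j:\hat\beta_j\neq\tilde\beta_j\}.$$ **Theorem (oracle property of the Transfer Lasso, deterministic source parameter).** Suppose that $S=T$ and that $\operatorname{sgn}(\tilde\beta_j-\beta^*_j)=\operatorname{sgn}(\beta^*_j)$ for all $j\in S$. If $(\lambda_n+\eta_n)/\sqrt n\to\infty$ and $(\lambda_n-\eta_n)/\sqrt n\to0$, then $$\lim_{n\to\infty}P(\hat S_n=S)=\lim_{n\to\infty}P(\hat T_n=T)=1$$ and $$\sqrt n\,(\hat\beta_S-\beta^*_S)\overset{d}{\to}\mathcal N(0,\sigma^2C_{SS}^{-1}),$$ where $v_S$ denotes the restriction of a vector to the indices in $S$ and $C_{SS}$ the submatrix of $C$ with rows and columns in $S$. -/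

import Mathlib

open Filter Topology MeasureTheory ProbabilityTheory
open scoped Matrix NNReal

/-- The active set (support) `{j : β j ≠ 0}` of a parameter vector. -/
noncomputable def activeSet {p : ℕ} (β : EuclideanSpace ℝ (Fin p)) : Finset (Fin p) :=
  {j | β j ≠ 0}

/-- The change set `{j : β' j ≠ β j}` of coordinates in which `β` differs from the source
parameter `β'`. -/
noncomputable def changeSet {p : ℕ} (β' β : EuclideanSpace ℝ (Fin p)) : Finset (Fin p) :=
  {j | β' j ≠ β j}

/-- The restriction `v_S` of a vector to the index set `S`. -/
noncomputable def restrictTo {p : ℕ} (S : Finset (Fin p)) (v : EuclideanSpace ℝ (Fin p)) :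
    EuclideanSpace ℝ S :=
  WithLp.toLp 2 fun j : S => v j

/-- The principal submatrix `M_SS`. -/
def principalSubmatrix {p : ℕ} (S : Finset (Fin p)) (M : Matrix (Fin p) (Fin p) ℝ) :
    Matrix S S ℝ :=
  M.submatrix (fun j : S => (j : Fin p)) (fun j : S => (j : Fin p))

/-- The response `y = X β + ε` of the linear model. -/
noncomputable def linearResponse {n p : ℕ} (X : Matrix (Fin n) (Fin p) ℝ)
    (β : EuclideanSpace ℝ (Fin p)) (ε : EuclideanSpace ℝ (Fin n)) : EuclideanSpace ℝ (Fin n) :=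
  WithLp.toLp 2 (X *ᵥ β) + ε

/-- The Transfer Lasso objective
`(1/n) ‖y - X β‖₂² + (lam/n) ∑ |β j| + (eta/n) ∑ |β j - β' j|`, with source parameter `β'`. -/
noncomputable def transferLassoObjective {n p : ℕ} (X : Matrix (Fin n) (Fin p) ℝ)
    (y : EuclideanSpace ℝ (Fin n)) (β' : EuclideanSpace ℝ (Fin p)) (lam eta : ℝ)
    (β : EuclideanSpace ℝ (Fin p)) : ℝ :=
  1 / (n : ℝ) * ‖y - WithLp.toLp 2 (X *ᵥ β)‖ ^ 2
    + lam / (n : ℝ) * ∑ j, |β j|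
    + eta / (n : ℝ) * ∑ j, |β j - β' j|

/-- `b` is a Transfer Lasso estimate: a global minimizer of the Transfer Lasso objective. -/
def IsTransferLasso {n p : ℕ} (X : Matrix (Fin n) (Fin p) ℝ) (y : EuclideanSpace ℝ (Fin n))
    (β' : EuclideanSpace ℝ (Fin p)) (lam eta : ℝ) (b : EuclideanSpace ℝ (Fin p)) : Prop :=
  ∀ β : EuclideanSpace ℝ (Fin p),
    transferLassoObjective X y β' lam eta b ≤ transferLassoObjective X y β' lam eta β

/-!
A vector is the Transfer Lasso estimate as soon as the negative gradient of the residual sum of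
squares there is a subgradient of the penalty. On `S` the true parameter lies strictly between zero
and the source parameter, so near `β*` the two penalties have slopes of opposite signs and
contribute the linear term `± (λ - η)`, which is `o(√n)`. Off `S` both penalties have their kink at
`0`, where every slope of size at most `λ + η ≫ √n` is a subgradient.

The candidate is therefore the penalized least squares estimator of the submodel `S`. Its rescaled
error and its dual certificate are affine images of the score `n^{-1/2} Xᵀ ε`, hence exactly
Gaussian, and their means and covariances converge, so that both converge in distribution and are
stochastically bounded. With probability tending to one the candidate thus has the signs of `β*`
on `S` and a feasible dual certificate, and then it is the estimate itself.
-/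

section ConvergenceInDistribution

lemma abs_integral_comp_sub_integral_comp_le {Ω E : Type*} [MeasurableSpace Ω] [TopologicalSpace E]
    [MeasurableSpace E] [OpensMeasurableSpace E]
    {P : Measure Ω} [IsFiniteMeasure P] {Y Z : Ω → E} (hY : AEMeasurable Y P)
    (hZ : AEMeasurable Z P) (f : BoundedContinuousFunction E ℝ) :
    |∫ ω, f (Y ω) ∂P - ∫ ω, f (Z ω) ∂P| ≤ 2 * ‖f‖ * P.real {ω | Y ω ≠ Z ω} := by
  have hint {W : Ω → E} (hW : AEMeasurable W P) : Integrable (fun ω => f (W ω)) P :=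
    Integrable.of_bound (C := ‖f‖) (f := fun ω => f (W ω))
      (f.continuous.measurable.comp_aemeasurable hW).aestronglyMeasurable
      (ae_of_all _ fun ω => f.norm_coe_le_norm (W ω))
  set B := toMeasurable P {ω | Y ω ≠ Z ω}
  have hB : MeasurableSet B := measurableSet_toMeasurable _ _
  rw [← integral_sub (hint hY) (hint hZ)]
  calc |∫ ω, (f (Y ω) - f (Z ω)) ∂P| ≤ ∫ ω, B.indicator (fun _ => 2 * ‖f‖) ω ∂P := by
        rw [← Real.norm_eq_abs]
        refine norm_integral_le_of_norm_le ((integrable_const (μ := P) _).indicator hB)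
          (ae_of_all _ fun ω => ?_)
        by_cases hω : ω ∈ B
        · rw [Set.indicator_of_mem hω, ← dist_eq_norm]
          exact f.dist_le_two_norm _ _
        · have hYZ : Y ω = Z ω := not_not.1 fun hne => hω (subset_toMeasurable _ _ hne)
          simp [Set.indicator_of_notMem hω, hYZ]
    _ = 2 * ‖f‖ * P.real {ω | Y ω ≠ Z ω} := by
        rw [integral_indicator_const _ hB, smul_eq_mul, mul_comm, Measure.real, Measure.real,
          measure_toMeasurable]

variable {ι Ω' E : Type*} {Ω : ι → Type*} [∀ i, MeasurableSpace (Ω i)] [MeasurableSpace Ω']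
  {P : (i : ι) → Measure (Ω i)} {P' : Measure Ω'} {l : Filter ι}

lemma tendsto_measure_not_zero_mono {Q R : (i : ι) → Ω i → Prop}
    (hQ : Tendsto (fun i => P i {ω | ¬Q i ω}) l (𝓝 0)) (hQR : ∀ i ω, Q i ω → R i ω) :
    Tendsto (fun i => P i {ω | ¬R i ω}) l (𝓝 0) :=
  tendsto_of_tendsto_of_tendsto_of_le_of_le tendsto_const_nhds hQ (fun _ => zero_le)
    fun i => measure_mono fun ω => mt (hQR i ω)

variable [∀ i, IsProbabilityMeasure (P i)] [IsProbabilityMeasure P']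

lemma tendsto_measure_one_of_tendsto_measure_compl_zero {A : (i : ι) → Set (Ω i)}
    (hA : Tendsto (fun i => P i (A i)ᶜ) l (𝓝 0)) :
    Tendsto (fun i => P i (A i)) l (𝓝 1) := by
  have hlower : Tendsto (fun i => 1 - P i (A i)ᶜ) l (𝓝 1) := by
    simpa using ENNReal.Tendsto.sub tendsto_const_nhds hA (Or.inl ENNReal.one_ne_top)
  refine tendsto_of_tendsto_of_tendsto_of_le_of_le hlower tendsto_const_nhds (fun i => ?_)
    fun i => prob_le_one
  exact tsub_le_iff_right.2 (measure_univ (μ := P i) ▸ measure_univ_le_add_compl (A i))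

lemma tendstoInDistribution_of_tendsto_measure_ne [TopologicalSpace E] [MeasurableSpace E]
    [OpensMeasurableSpace E] {X Y : (i : ι) → Ω i → E} {Z : Ω' → E}
    (hY : TendstoInDistribution Y l Z P P') (hX : ∀ i, AEMeasurable (X i) (P i))
    (hXY : Tendsto (fun i => P i {ω | X i ω ≠ Y i ω}) l (𝓝 0)) :
    TendstoInDistribution X l Z P P' where
  forall_aemeasurable := hX
  aemeasurable_limit := hY.aemeasurable_limit
  tendsto := by
    have hYlim := ProbabilityMeasure.tendsto_iff_forall_integral_tendsto.1 hY.tendsto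
    refine ProbabilityMeasure.tendsto_iff_forall_integral_tendsto.2 fun f => ?_
    have hdiff : Tendsto (fun i => ∫ ω, f (X i ω) ∂P i - ∫ ω, f (Y i ω) ∂P i) l (𝓝 0) := by
      have hreal := (ENNReal.tendsto_toReal ENNReal.zero_ne_top).comp hXY
      refine squeeze_zero_norm
        (fun i => abs_integral_comp_sub_integral_comp_le (hX i) (hY.forall_aemeasurable i) f) ?_
      simpa [Measure.real, Function.comp_def] using hreal.const_mul (2 * ‖f‖)
    have hf {μ : Measure E} : AEStronglyMeasurable f μ :=
      f.continuous.measurable.aestronglyMeasurable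
    have hsum := hdiff.add (hYlim f)
    simp only [ProbabilityMeasure.coe_mk, zero_add, integral_map (hX _) hf,
      integral_map (hY.forall_aemeasurable _) hf, sub_add_cancel] at hsum ⊢
    exact hsum

lemma tendsto_measure_norm_ge_of_tendstoInDistribution [NormedAddCommGroup E]
    [MeasurableSpace E] [OpensMeasurableSpace E] {Y : (i : ι) → Ω i → E} {Z : Ω' → E}
    (hY : TendstoInDistribution Y l Z P P') {c : ι → ℝ} (hc : Tendsto c l atTop) :
    Tendsto (fun i => P i {ω | c i ≤ ‖Y i ω‖}) l (𝓝 0) := by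
  have hclosed (k : ℕ) : IsClosed {x : E | (k : ℝ) ≤ ‖x‖} :=
    isClosed_le continuous_const continuous_norm
  have htail : Tendsto (fun k : ℕ => P'.map Z {x : E | (k : ℝ) ≤ ‖x‖}) atTop (𝓝 0) := by
    have : IsProbabilityMeasure (P'.map Z) := Measure.isProbabilityMeasure_map hY.aemeasurable_limit
    have hempty : ⋂ k : ℕ, {x : E | (k : ℝ) ≤ ‖x‖} = ∅ := by
      ext x
      simpa using exists_nat_gt ‖x‖
    rw [← measure_empty (μ := P'.map Z), ← hempty]
    exact tendsto_measure_iInter_atTop (fun k => (hclosed k).nullMeasurableSet)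
      (fun k k' hk x (hx : (k' : ℝ) ≤ ‖x‖) => le_trans (by exact_mod_cast hk) hx)
      ⟨0, measure_ne_top _ _⟩
  refine ENNReal.tendsto_nhds_zero.2 fun δ hδ => ?_
  obtain ⟨k, hk⟩ := (htail.eventually_lt_const hδ).exists
  have hlimsup := ProbabilityMeasure.limsup_measure_closed_le_of_tendsto hY.tendsto (hclosed k)
  filter_upwards [eventually_lt_of_limsup_lt (hlimsup.trans_lt hk), hc.eventually_ge_atTop (k : ℝ)]
    with i hi hci
  rw [ProbabilityMeasure.coe_mk,
    Measure.map_apply_of_aemeasurable (hY.forall_aemeasurable i) (hclosed k).measurableSet] at hi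
  exact (measure_mono fun ω hω => hci.trans hω).trans hi.le

end ConvergenceInDistribution

section Gaussian

variable {ι κ Ω : Type*} [Fintype ι] [MeasurableSpace Ω] {P : Measure Ω}

lemma continuous_toLp_mulVec (T : Matrix κ ι ℝ) :
    Continuous fun x : EuclideanSpace ℝ ι => WithLp.toLp 2 (T *ᵥ x) := by
  fun_prop

lemma charFun_map_toLp_mulVec [Fintype κ] {ξ : Ω → EuclideanSpace ℝ ι}
    (hξ : AEMeasurable ξ P) (T : Matrix κ ι ℝ) (t : EuclideanSpace ℝ κ) :
    charFun (P.map fun ω => WithLp.toLp 2 (T *ᵥ ξ ω)) t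
      = charFun (P.map ξ) (WithLp.toLp 2 (Tᵀ *ᵥ t)) := by
  have hinner (x : EuclideanSpace ℝ ι) : inner ℝ (WithLp.toLp 2 (T *ᵥ x)) t
      = inner ℝ x (WithLp.toLp 2 (Tᵀ *ᵥ t)) := by
    simp only [EuclideanSpace.inner_eq_star_dotProduct, star_trivial, Matrix.dotProduct_mulVec,
      Matrix.mulVec_transpose]
  have hT : AEMeasurable (fun ω => WithLp.toLp 2 (T *ᵥ ξ ω)) P :=
    (continuous_toLp_mulVec T).measurable.comp_aemeasurable hξ
  rw [charFun_apply, charFun_apply, integral_map hT (by fun_prop),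
    integral_map hξ (by fun_prop)]
  simp only [hinner]

lemma charFun_map_of_iIndepFun_gaussianReal [IsProbabilityMeasure P] {v : ℝ≥0}
    {ξ : Ω → EuclideanSpace ℝ ι} (hlaw : ∀ i, HasLaw (fun ω => ξ ω i) (gaussianReal 0 v) P)
    (hindep : iIndepFun (fun i ω => ξ ω i) P) (s : EuclideanSpace ℝ ι) :
    charFun (P.map ξ) s = Complex.exp (-((v * (s ⬝ᵥ s) / 2 : ℝ) : ℂ)) := by
  have hprod := (iIndepFun_iff_charFun_pi fun i => (hlaw i).aemeasurable).1 hindep s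
  simp only [WithLp.toLp_ofLp] at hprod
  simp only [hprod, (hlaw _).map_eq, charFun_gaussianReal, ← Complex.exp_sum, dotProduct]
  congr 1
  push_cast
  simp only [mul_zero, zero_mul, zero_sub, Finset.sum_neg_distrib, Finset.mul_sum, Finset.sum_div,
    sq]

lemma hasLaw_multivariateGaussian_add_mulVec [IsProbabilityMeasure P] [Fintype κ] [DecidableEq κ]
    {v : ℝ≥0} {ξ : Ω → EuclideanSpace ℝ ι}
    (hlaw : ∀ i, HasLaw (fun ω => ξ ω i) (gaussianReal 0 v) P)
    (hindep : iIndepFun (fun i ω => ξ ω i) P) (m : EuclideanSpace ℝ κ) (T : Matrix κ ι ℝ) :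
    HasLaw (fun ω => m + WithLp.toLp 2 (T *ᵥ ξ ω)) (multivariateGaussian m (v • (T * Tᵀ))) P := by
  have hξ : AEMeasurable ξ P := by
    have := fun i => (hlaw i).aemeasurable
    exact (PiLp.continuous_toLp 2 _).measurable.comp_aemeasurable (aemeasurable_pi_lambda _ this)
  have hT : AEMeasurable (fun ω => WithLp.toLp 2 (T *ᵥ ξ ω)) P :=
    (continuous_toLp_mulVec T).measurable.comp_aemeasurable hξ
  have hpos : (v • (T * Tᵀ)).PosSemidef :=
    (Matrix.posSemidef_self_mul_conjTranspose T).smul v.2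
  have hquad (t : EuclideanSpace ℝ κ) :
      t ⬝ᵥ (v • (T * Tᵀ)) *ᵥ t = v * ((Tᵀ *ᵥ t) ⬝ᵥ (Tᵀ *ᵥ t)) := by
    rw [Matrix.smul_mulVec, dotProduct_smul, ← Matrix.mulVec_mulVec, Matrix.dotProduct_mulVec,
      ← Matrix.mulVec_transpose]
    rfl
  refine ⟨hT.const_add m, Measure.ext_of_charFun (funext fun t => ?_)⟩
  have hmap := AEMeasurable.map_map_of_aemeasurable (g := fun x => m + x)
    (measurable_const_add m).aemeasurable hT
  rw [Function.comp_def] at hmap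
  rw [← hmap, charFun_map_const_add, charFun_map_toLp_mulVec hξ,
    charFun_map_of_iIndepFun_gaussianReal hlaw hindep, charFun_multivariateGaussian hpos, hquad,
    ← Complex.exp_add]
  simp only [real_inner_comm m t]
  push_cast
  ring_nf

lemma tendsto_multivariateGaussian [DecidableEq ι] {m : ℕ → EuclideanSpace ℝ ι}
    {m₀ : EuclideanSpace ℝ ι} {S : ℕ → Matrix ι ι ℝ}
    {S₀ : Matrix ι ι ℝ} (hS : ∀ n, (S n).PosSemidef) (hS₀ : S₀.PosSemidef)
    (hm : Tendsto m atTop (𝓝 m₀)) (hSlim : Tendsto S atTop (𝓝 S₀)) :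
    Tendsto (β := ProbabilityMeasure (EuclideanSpace ℝ ι))
      (fun n => ⟨multivariateGaussian (m n) (S n), inferInstance⟩) atTop
      (𝓝 ⟨multivariateGaussian m₀ S₀, inferInstance⟩) := by
  refine ProbabilityMeasure.tendsto_of_tendsto_charFun fun t => ?_
  simp only [ProbabilityMeasure.coe_mk, charFun_multivariateGaussian (hS _),
    charFun_multivariateGaussian hS₀]
  have hquad : Tendsto (fun n => t ⬝ᵥ S n *ᵥ t) atTop (𝓝 (t ⬝ᵥ S₀ *ᵥ t)) :=
    ((by fun_prop : Continuous fun A : Matrix ι ι ℝ => t ⬝ᵥ A *ᵥ t).tendsto S₀).comp hSlim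
  have hmean : Tendsto (fun n => inner ℝ t (m n)) atTop (𝓝 (inner ℝ t m₀)) :=
    tendsto_const_nhds.inner hm
  exact (Complex.continuous_exp.tendsto _).comp
    (((Complex.continuous_ofReal.tendsto _).comp hmean |>.mul_const Complex.I).sub
      (((Complex.continuous_ofReal.tendsto _).comp hquad).div_const 2))

end Gaussian

lemma abs_add_sign_mul_sub_le (a x : ℝ) : |a| + SignType.sign a * (x - a) ≤ |x| := by
  rcases lt_trichotomy a 0 with ha | rfl | ha
  · simp only [abs_of_neg ha, sign_neg ha, SignType.coe_neg_one]
    linarith [neg_abs_le x]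
  · simp
  · simp only [abs_of_pos ha, sign_pos ha, SignType.coe_one]
    linarith [le_abs_self x]

lemma sign_add_eq_of_abs_lt {x y : ℝ} (h : |y| < |x|) :
    SignType.sign (x + y) = SignType.sign x := by
  rcases lt_trichotomy x 0 with hx | rfl | hx
  · rw [sign_neg hx, sign_neg (by linarith [abs_of_neg hx, le_abs_self y])]
  · exact absurd h (by simp)
  · rw [sign_pos hx, sign_pos (by linarith [abs_of_pos hx, neg_abs_le y])]

lemma abs_inv_mul_lt {s x u : ℝ} (h : |u| < s * |x|) : |s⁻¹ * u| < |x| := by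
  have hs : 0 < s := by
    by_contra! hs
    nlinarith [abs_nonneg u, abs_nonneg x]
  rwa [abs_mul, abs_inv, abs_of_pos hs, inv_mul_lt_iff₀ hs]

lemma transferPenalty_subgradient_of_sign_eq {lam eta a a' : ℝ} (hlam : 0 ≤ lam) (heta : 0 ≤ eta)
    (h : SignType.sign (a' - a) = SignType.sign a) (x : ℝ) :
    lam * |a| + eta * |a - a'| + (lam - eta) * SignType.sign a * (x - a)
      ≤ lam * |x| + eta * |x - a'| := by
  have hneg : SignType.sign (a - a') = -SignType.sign a := by
    rw [← neg_sub, Left.sign_neg, h]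
  have h1 := mul_le_mul_of_nonneg_left (abs_add_sign_mul_sub_le a x) hlam
  have h2 := mul_le_mul_of_nonneg_left (abs_add_sign_mul_sub_le (a - a') (x - a')) heta
  rw [hneg, SignType.coe_neg] at h2
  linarith

lemma transferPenalty_subgradient_at_zero {lam eta g : ℝ} (hg : |g| ≤ lam + eta) (x : ℝ) :
    g * x ≤ lam * |x| + eta * |x| := by
  calc g * x ≤ |g| * |x| := by rw [← abs_mul]; exact le_abs_self _
    _ ≤ (lam + eta) * |x| := by gcongr
    _ = lam * |x| + eta * |x| := add_mul ..

lemma norm_sub_mulVec_sq_add_sum_lt {m ι : Type*} [Fintype m] [Fintype ι] {X : Matrix m ι ℝ}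
    (hX : Function.Injective X.mulVec) {y : EuclideanSpace ℝ m} {pen : ι → ℝ → ℝ}
    {b₀ b : EuclideanSpace ℝ ι} (hb : b ≠ b₀)
    (hpen : ∀ j x, pen j (b₀ j) + 2 * (Xᵀ *ᵥ (y - X *ᵥ b₀)) j * (x - b₀ j)
      ≤ pen j x) :
    ‖y - WithLp.toLp 2 (X *ᵥ b₀)‖ ^ 2 + ∑ j, pen j (b₀ j)
      < ‖y - WithLp.toLp 2 (X *ᵥ b)‖ ^ 2 + ∑ j, pen j (b j) := by
  set r : EuclideanSpace ℝ m := y - WithLp.toLp 2 (X *ᵥ b₀) with hr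
  set d : EuclideanSpace ℝ m := WithLp.toLp 2 (X *ᵥ (b - b₀)) with hd
  have hres : y - WithLp.toLp 2 (X *ᵥ b) = r - d := by
    simp only [hr, hd, Matrix.mulVec_sub, WithLp.toLp_sub]
    abel
  have hd_pos : 0 < ‖d‖ := by
    rw [norm_pos_iff]
    intro h0
    refine hb (sub_eq_zero.1 (WithLp.ofLp_injective 2 (hX ?_)))
    simpa [hd] using h0
  have hinner : inner ℝ r d = ∑ j, (Xᵀ *ᵥ r) j * (b j - b₀ j) := by
    rw [EuclideanSpace.inner_eq_star_dotProduct]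
    simp only [hd, star_trivial]
    rw [dotProduct_comm, Matrix.dotProduct_mulVec, ← Matrix.mulVec_transpose]
    rfl
  have hsum : ∑ j, pen j (b₀ j) + 2 * inner ℝ r d ≤ ∑ j, pen j (b j) := by
    rw [hinner, Finset.mul_sum, ← Finset.sum_add_distrib]
    exact Finset.sum_le_sum fun j _ => by rw [← mul_assoc]; exact hpen j (b j)
  rw [hres, norm_sub_sq_real r d]
  nlinarith

lemma IsTransferLasso.eq_of_forall_subgradient {n p : ℕ} {X : Matrix (Fin n) (Fin p) ℝ}
    (hX : Function.Injective X.mulVec) {y : EuclideanSpace ℝ (Fin n)}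
    {β' b₀ b : EuclideanSpace ℝ (Fin p)} {lam eta : ℝ}
    (hsub : ∀ j x, lam * |b₀ j| + eta * |b₀ j - β' j|
      + 2 * (Xᵀ *ᵥ (y - X *ᵥ b₀)) j * (x - b₀ j) ≤ lam * |x| + eta * |x - β' j|)
    (hb : IsTransferLasso X y β' lam eta b) : b = b₀ := by
  rcases Nat.eq_zero_or_pos n with rfl | hn
  · exact WithLp.ofLp_injective 2 (hX (Subsingleton.elim _ _))
  by_contra hne
  have hlt := norm_sub_mulVec_sq_add_sum_lt hX
    (pen := fun j x => lam * |x| + eta * |x - β' j|) hne hsub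
  have hle := mul_le_mul_of_nonneg_left (hb b₀) (Nat.cast_nonneg (α := ℝ) n)
  have hn0 : (n : ℝ) ≠ 0 := by positivity
  have hobj (β : EuclideanSpace ℝ (Fin p)) : n * transferLassoObjective X y β' lam eta β
      = ‖y - WithLp.toLp 2 (X *ᵥ β)‖ ^ 2 + ∑ j, (lam * |β j| + eta * |β j - β' j|) := by
    rw [transferLassoObjective, Finset.sum_add_distrib, ← Finset.mul_sum, ← Finset.mul_sum]
    field_simp
    ring
  rw [hobj, hobj] at hle
  exact hle.not_gt hlt

section SelectionMatrix

variable {p : ℕ} (S : Finset (Fin p))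

/-- The matrix of the coordinate restriction `v ↦ v_S`; its transpose extends a vector indexed by
`S` by zero. -/
def selectionMatrix : Matrix S (Fin p) ℝ :=
  (1 : Matrix (Fin p) (Fin p) ℝ).submatrix (↑) id

lemma selectionMatrix_mulVec_apply (v : Fin p → ℝ) (j : S) : (selectionMatrix S *ᵥ v) j = v j := by
  simp [selectionMatrix, Matrix.mulVec, dotProduct, Matrix.one_apply]

lemma selectionMatrix_transpose_mulVec_apply_of_mem (u : S → ℝ) {j : Fin p} (hj : j ∈ S) :
    ((selectionMatrix S)ᵀ *ᵥ u) j = u ⟨j, hj⟩ := by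
  simp only [selectionMatrix, Matrix.mulVec, dotProduct, Matrix.transpose_apply,
    Matrix.submatrix_apply, id_eq, Matrix.one_apply, ite_mul, one_mul, zero_mul]
  rw [Finset.sum_eq_single ⟨j, hj⟩] <;> aesop

lemma selectionMatrix_transpose_mulVec_apply_of_notMem (u : S → ℝ) {j : Fin p} (hj : j ∉ S) :
    ((selectionMatrix S)ᵀ *ᵥ u) j = 0 := by
  simp only [selectionMatrix, Matrix.mulVec, dotProduct, Matrix.transpose_apply,
    Matrix.submatrix_apply, id_eq, Matrix.one_apply, ite_mul, one_mul, zero_mul]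
  exact Finset.sum_eq_zero fun i _ => if_neg fun h : (i : Fin p) = j => hj (h ▸ i.2)

lemma principalSubmatrix_eq_mul (M : Matrix (Fin p) (Fin p) ℝ) :
    principalSubmatrix S M = selectionMatrix S * M * (selectionMatrix S)ᵀ := by
  ext i j
  simp [principalSubmatrix, selectionMatrix, Matrix.mul_apply, Matrix.one_apply]

end SelectionMatrix

section Oracle

variable {n p : ℕ}

/-- The empirical Gram matrix `C_n = n⁻¹ Xᵀ X`. -/
noncomputable def empiricalGram (X : Matrix (Fin n) (Fin p) ℝ) : Matrix (Fin p) (Fin p) ℝ :=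
  (1 / (n : ℝ)) • (Xᵀ * X)

/-- The normalized score `n^{-1/2} Xᵀ ε`. -/
noncomputable def score (X : Matrix (Fin n) (Fin p) ℝ) (ε : EuclideanSpace ℝ (Fin n)) :
    EuclideanSpace ℝ (Fin p) :=
  WithLp.toLp 2 ((√(n : ℝ))⁻¹ • (Xᵀ *ᵥ ε))

/-- The matrix `M_SS⁻¹ R_S`, where `R_S` is the selection matrix of `S`: it sends the score to the
least squares error of the submodel with covariates in `S`. -/
noncomputable def oracleMatrix (S : Finset (Fin p)) (M : Matrix (Fin p) (Fin p) ℝ) :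
    Matrix S (Fin p) ℝ :=
  (principalSubmatrix S M)⁻¹ * selectionMatrix S

/-- The rescaled error `√n (β_S - β*_S)` of the oracle estimator, which knows `S` and replaces the
penalty by a linear function whose gradient on `S` is `2 √n τ`. -/
noncomputable def oracleError (X : Matrix (Fin n) (Fin p) ℝ) (S : Finset (Fin p))
    (τ : EuclideanSpace ℝ (Fin p)) (ε : EuclideanSpace ℝ (Fin n)) : EuclideanSpace ℝ S :=
  WithLp.toLp 2 (oracleMatrix S (empiricalGram X) *ᵥ (score X ε - τ))

/-- The oracle estimator of the true parameter `β`, which vanishes off `S` when `β` does. -/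
noncomputable def oracleEstimator (X : Matrix (Fin n) (Fin p) ℝ) (S : Finset (Fin p))
    (τ β : EuclideanSpace ℝ (Fin p)) (ε : EuclideanSpace ℝ (Fin n)) :
    EuclideanSpace ℝ (Fin p) :=
  β + (√(n : ℝ))⁻¹ • WithLp.toLp 2 ((selectionMatrix S)ᵀ *ᵥ oracleError X S τ ε)

/-- The dual certificate of the oracle estimator: its normalized residual correlations
`n^{-1/2} Xᵀ (y - X b)`. -/
noncomputable def oracleDual (X : Matrix (Fin n) (Fin p) ℝ) (S : Finset (Fin p))
    (τ : EuclideanSpace ℝ (Fin p)) (ε : EuclideanSpace ℝ (Fin n)) : EuclideanSpace ℝ (Fin p) :=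
  score X ε
    - WithLp.toLp 2 (empiricalGram X *ᵥ ((selectionMatrix S)ᵀ *ᵥ oracleError X S τ ε))

/-- Half of the slope of the rescaled Transfer Lasso penalty at `β` on the coordinates where
`β'` lies beyond `β`, so that the two absolute values have slopes of opposite signs. -/
noncomputable def penaltyShift (n : ℕ) (lam eta : ℝ) (β : EuclideanSpace ℝ (Fin p)) :
    EuclideanSpace ℝ (Fin p) :=
  WithLp.toLp 2 fun j => (lam - eta) / √(n : ℝ) / 2 * SignType.sign (β j)

variable {X : Matrix (Fin n) (Fin p) ℝ} {S : Finset (Fin p)}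
  {τ β β' b : EuclideanSpace ℝ (Fin p)} {ε : EuclideanSpace ℝ (Fin n)} {j : Fin p}
  {lam eta : ℝ}

lemma posSemidef_empiricalGram (X : Matrix (Fin n) (Fin p) ℝ) : (empiricalGram X).PosSemidef :=
  (Matrix.posSemidef_conjTranspose_mul_self X).smul (by positivity)

lemma mulVec_injective_of_posDef_empiricalGram (hX : (empiricalGram X).PosDef) :
    Function.Injective X.mulVec := by
  have hgram : Function.Injective (empiricalGram X).mulVec :=
    Matrix.mulVec_injective_iff_isUnit.2 hX.isUnit
  intro v w hvw
  apply hgram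
  simp only [empiricalGram, Matrix.smul_mulVec, ← Matrix.mulVec_mulVec]
  rw [show X *ᵥ v = X *ᵥ w from hvw]

lemma posDef_principalSubmatrix {M : Matrix (Fin p) (Fin p) ℝ} (hM : M.PosDef)
    (S : Finset (Fin p)) : (principalSubmatrix S M).PosDef :=
  hM.submatrix Subtype.val_injective

lemma oracleEstimator_apply_of_mem (hj : j ∈ S) :
    oracleEstimator X S τ β ε j = β j + (√(n : ℝ))⁻¹ * oracleError X S τ ε ⟨j, hj⟩ := by
  simp [oracleEstimator, selectionMatrix_transpose_mulVec_apply_of_mem S _ hj]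

lemma oracleEstimator_apply_of_notMem (hj : j ∉ S) : oracleEstimator X S τ β ε j = β j := by
  simp [oracleEstimator, selectionMatrix_transpose_mulVec_apply_of_notMem S _ hj]

lemma sign_oracleEstimator (hj : j ∈ S)
    (h : |oracleError X S τ ε ⟨j, hj⟩| < √(n : ℝ) * |β j|) :
    SignType.sign (oracleEstimator X S τ β ε j) = SignType.sign (β j) := by
  rw [oracleEstimator_apply_of_mem hj]
  exact sign_add_eq_of_abs_lt (abs_inv_mul_lt h)

lemma sign_sub_oracleEstimator (hj : j ∈ S)
    (h : |oracleError X S τ ε ⟨j, hj⟩| < √(n : ℝ) * |β' j - β j|) :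
    SignType.sign (β' j - oracleEstimator X S τ β ε j) = SignType.sign (β' j - β j) := by
  rw [oracleEstimator_apply_of_mem hj, ← sub_sub, sub_eq_add_neg]
  exact sign_add_eq_of_abs_lt (by rw [abs_neg]; exact abs_inv_mul_lt h)

lemma sqrt_smul_restrictTo_oracleEstimator_sub (hn : 0 < n) :
    √(n : ℝ) • restrictTo S (oracleEstimator X S τ β ε - β) = oracleError X S τ ε := by
  ext ⟨j, hj⟩
  have : √(n : ℝ) ≠ 0 := by positivity
  simp [restrictTo, oracleEstimator_apply_of_mem hj, this]

lemma oracleDual_apply_of_mem (hX : (empiricalGram X).PosDef) (hj : j ∈ S) :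
    oracleDual X S τ ε j = τ j := by
  have hD : IsUnit (principalSubmatrix S (empiricalGram X)).det :=
    (posDef_principalSubmatrix hX S).det_pos.ne'.isUnit
  have hnormal : selectionMatrix S *ᵥ (empiricalGram X *ᵥ
      ((selectionMatrix S)ᵀ *ᵥ oracleError X S τ ε)) = selectionMatrix S *ᵥ (score X ε - τ) := by
    rw [Matrix.mulVec_mulVec, Matrix.mulVec_mulVec, ← principalSubmatrix_eq_mul, oracleError,
      oracleMatrix, Matrix.mulVec_mulVec, Matrix.mul_nonsing_inv_cancel_left _ _ hD]
  have hnormal_j := congrFun hnormal ⟨j, hj⟩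
  simp only [selectionMatrix_mulVec_apply, Pi.sub_apply] at hnormal_j
  simp only [oracleDual, PiLp.sub_apply, hnormal_j]
  ring

lemma transpose_mulVec_linearResponse_sub_oracleEstimator (hn : 0 < n) :
    Xᵀ *ᵥ (linearResponse X β ε - X *ᵥ oracleEstimator X S τ β ε)
      = √(n : ℝ) • oracleDual X S τ ε := by
  have hsqrt : √(n : ℝ) ≠ 0 := by positivity
  have hscale : √(n : ℝ) * (n : ℝ)⁻¹ = (√(n : ℝ))⁻¹ := Real.sqrt_div_self
  simp [linearResponse, oracleEstimator, oracleDual, score, empiricalGram, Matrix.mulVec_add,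
    Matrix.mulVec_sub, Matrix.mulVec_smul, Matrix.smul_mulVec, smul_sub, smul_smul, hscale, hsqrt,
    Matrix.mul_assoc]

lemma activeSet_oracleEstimator
    (h : ∀ j : S, |oracleError X S τ ε j| < √(n : ℝ) * |β j|) :
    activeSet (oracleEstimator X S τ β ε) = activeSet β := by
  ext j
  simp only [activeSet, Finset.mem_filter, Finset.mem_univ, true_and]
  by_cases hj : j ∈ S
  · rw [← sign_ne_zero, sign_oracleEstimator hj (h ⟨j, hj⟩), sign_ne_zero]
  · rw [oracleEstimator_apply_of_notMem hj]

lemma changeSet_oracleEstimator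
    (h : ∀ j : S, |oracleError X S τ ε j| < √(n : ℝ) * |β' j - β j|) :
    changeSet β' (oracleEstimator X S τ β ε) = changeSet β' β := by
  ext j
  simp only [changeSet, Finset.mem_filter, Finset.mem_univ, true_and]
  by_cases hj : j ∈ S
  · rw [← sub_ne_zero, ← sign_ne_zero, sign_sub_oracleEstimator hj (h ⟨j, hj⟩), sign_ne_zero,
      sub_ne_zero]
  · rw [oracleEstimator_apply_of_notMem hj]

lemma IsTransferLasso.eq_oracleEstimator (hn : 0 < n) (hX : (empiricalGram X).PosDef)
    (hlam : 0 ≤ lam) (heta : 0 ≤ eta) (hzero : ∀ j ∉ S, β j = 0 ∧ β' j = 0)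
    (hsign : ∀ j ∈ S, SignType.sign (β' j - β j) = SignType.sign (β j))
    (herror : ∀ j : S, |oracleError X S (penaltyShift n lam eta β) ε j| < √(n : ℝ) * |β j| ∧
      |oracleError X S (penaltyShift n lam eta β) ε j| < √(n : ℝ) * |β' j - β j|)
    (hdual : ∀ j, 2 * √(n : ℝ) * |oracleDual X S (penaltyShift n lam eta β) ε j| ≤ lam + eta)
    (hb : IsTransferLasso X (linearResponse X β ε) β' lam eta b) :
    b = oracleEstimator X S (penaltyShift n lam eta β) β ε := by
  have hsqrt : 0 < √(n : ℝ) := by positivity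
  refine hb.eq_of_forall_subgradient (mulVec_injective_of_posDef_empiricalGram hX) fun j x => ?_
  rw [transpose_mulVec_linearResponse_sub_oracleEstimator hn, Pi.smul_apply, smul_eq_mul]
  by_cases hj : j ∈ S
  · have hsb := sign_oracleEstimator hj (herror ⟨j, hj⟩).1
    have hsb' := sign_sub_oracleEstimator hj (herror ⟨j, hj⟩).2
    convert transferPenalty_subgradient_of_sign_eq hlam heta
      (hsb'.trans ((hsign j hj).trans hsb.symm)) x using 3
    rw [hsb, oracleDual_apply_of_mem hX hj, penaltyShift]
    field_simp
  · have hg : |2 * (√(n : ℝ) * oracleDual X S (penaltyShift n lam eta β) ε j)| ≤ lam + eta := by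
      simpa [abs_mul, mul_assoc, abs_of_pos hsqrt] using hdual j
    simpa [oracleEstimator_apply_of_notMem hj, hzero j hj]
      using transferPenalty_subgradient_at_zero hg x

lemma oracleMatrix_mul_mul_transpose {M : Matrix (Fin p) (Fin p) ℝ} (hM : M.PosDef)
    (S : Finset (Fin p)) :
    oracleMatrix S M * M * (oracleMatrix S M)ᵀ = (principalSubmatrix S M)⁻¹ := by
  have hD := posDef_principalSubmatrix hM S
  have hsymm : ((principalSubmatrix S M)⁻¹)ᵀ = (principalSubmatrix S M)⁻¹ := by
    simpa using hD.isHermitian.inv.eq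
  rw [oracleMatrix, Matrix.transpose_mul, hsymm, ← Matrix.mul_assoc, Matrix.mul_assoc _ _ M,
    Matrix.mul_assoc _ (_ * M), ← principalSubmatrix_eq_mul,
    Matrix.nonsing_inv_mul _ hD.det_pos.ne'.isUnit, Matrix.one_mul]

lemma oracleError_eq_add_mulVec_score :
    oracleError X S τ ε = -WithLp.toLp 2 (oracleMatrix S (empiricalGram X) *ᵥ τ)
      + WithLp.toLp 2 (oracleMatrix S (empiricalGram X) *ᵥ score X ε) := by
  rw [oracleError, Matrix.mulVec_sub, WithLp.toLp_sub]
  abel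

/-- The matrix `1 - M R_Sᵀ M_SS⁻¹ R_S`, which sends the score to the dual certificate of the
unpenalized least squares estimator of the submodel with covariates in `S`. -/
noncomputable def dualMatrix (S : Finset (Fin p)) (M : Matrix (Fin p) (Fin p) ℝ) :
    Matrix (Fin p) (Fin p) ℝ :=
  1 - M * (selectionMatrix S)ᵀ * oracleMatrix S M

lemma oracleDual_eq_add_mulVec_score :
    oracleDual X S τ ε = WithLp.toLp 2 ((1 - dualMatrix S (empiricalGram X)) *ᵥ τ)
      + WithLp.toLp 2 (dualMatrix S (empiricalGram X) *ᵥ score X ε) := by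
  simp only [oracleDual, oracleError, dualMatrix, Matrix.mulVec_mulVec, Matrix.mulVec_sub,
    Matrix.sub_mulVec, Matrix.one_mulVec, sub_sub_cancel, Matrix.mul_assoc]
  simp only [WithLp.toLp_sub, WithLp.toLp_ofLp]
  abel

lemma IsTransferLasso.oracle_property (hn : 0 < n) (hX : (empiricalGram X).PosDef)
    (hlam : 0 ≤ lam) (heta : 0 ≤ eta) (hzero : ∀ j ∉ S, β j = 0 ∧ β' j = 0)
    (hsign : ∀ j ∈ S, SignType.sign (β' j - β j) = SignType.sign (β j)) {δ : ℝ}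
    (hδ : ∀ j ∈ S, δ ≤ |β j| ∧ δ ≤ |β' j - β j|)
    (herror : ‖oracleError X S (penaltyShift n lam eta β) ε‖ < √(n : ℝ) * δ)
    (hdual : ‖oracleDual X S (penaltyShift n lam eta β) ε‖ < (lam + eta) / √(n : ℝ) / 2)
    (hb : IsTransferLasso X (linearResponse X β ε) β' lam eta b) :
    activeSet b = activeSet β ∧ changeSet β' b = changeSet β' β ∧
      √(n : ℝ) • restrictTo S (b - β) = oracleError X S (penaltyShift n lam eta β) ε := by
  have herror' (j : S) :
      |oracleError X S (penaltyShift n lam eta β) ε j| < √(n : ℝ) * |β j| ∧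
        |oracleError X S (penaltyShift n lam eta β) ε j| < √(n : ℝ) * |β' j - β j| := by
    have hj := (PiLp.norm_apply_le _ j).trans_lt herror
    exact ⟨hj.trans_le (by gcongr; exact (hδ j j.2).1), hj.trans_le (by gcongr; exact (hδ j j.2).2)⟩
  have hdual' (j : Fin p) :
      2 * √(n : ℝ) * |oracleDual X S (penaltyShift n lam eta β) ε j| ≤ lam + eta := by
    have hj := (PiLp.norm_apply_le _ j).trans hdual.le
    rw [div_div, le_div_iff₀ (by positivity), Real.norm_eq_abs] at hj
    linarith
  obtain rfl := hb.eq_oracleEstimator hn hX hlam heta hzero hsign herror' hdual'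
  exact ⟨activeSet_oracleEstimator fun j => (herror' j).1,
    changeSet_oracleEstimator fun j => (herror' j).2, sqrt_smul_restrictTo_oracleEstimator_sub hn⟩

end Oracle

section SupportSeparation

variable {p : ℕ} {β β' : EuclideanSpace ℝ (Fin p)}

lemma eq_zero_and_eq_zero_of_notMem_activeSet (hST : activeSet β = changeSet β' β) {j : Fin p}
    (hj : j ∉ activeSet β) : β j = 0 ∧ β' j = 0 := by
  have hβ : β j = 0 := by simpa [activeSet] using hj
  have hβ' : β' j = β j := by simpa [hST, changeSet] using hj
  exact ⟨hβ, hβ'.trans hβ⟩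

lemma exists_pos_le_abs_of_mem_activeSet (hST : activeSet β = changeSet β' β) :
    ∃ δ > 0, ∀ j ∈ activeSet β, δ ≤ |β j| ∧ δ ≤ |β' j - β j| := by
  have hle : ∀ᶠ δ in 𝓝[>] (0 : ℝ), ∀ j ∈ activeSet β, δ ≤ |β j| ∧ δ ≤ |β' j - β j| := by
    refine (Finset.eventually_all _).2 fun j hj => ?_
    have hβ : β j ≠ 0 := by simpa [activeSet] using hj
    have hβ' : β' j ≠ β j := by simpa [hST, changeSet] using hj
    exact nhdsWithin_le_nhds ((eventually_le_nhds (abs_pos.2 hβ)).and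
      (eventually_le_nhds (abs_pos.2 (sub_ne_zero.2 hβ'))))
  obtain ⟨δ, hδ, hpos⟩ := (hle.and self_mem_nhdsWithin).exists
  exact ⟨δ, hpos, hδ⟩

end SupportSeparation

section Limits

variable {α : Type*} {l : Filter α} {p : ℕ}

lemma tendsto_oracleMatrix {A : α → Matrix (Fin p) (Fin p) ℝ} {C : Matrix (Fin p) (Fin p) ℝ}
    (hC : C.PosDef) (hA : Tendsto A l (𝓝 C)) (S : Finset (Fin p)) :
    Tendsto (fun a => oracleMatrix S (A a)) l (𝓝 (oracleMatrix S C)) := by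
  have hdet : (principalSubmatrix S C).det ≠ 0 := (posDef_principalSubmatrix hC S).det_pos.ne'
  have hinv : ContinuousAt Ring.inverse (principalSubmatrix S C).det := by
    rw [Ring.inverse_eq_inv']
    exact continuousAt_inv₀ hdet
  have hsub : Tendsto (fun a => principalSubmatrix S (A a)) l (𝓝 (principalSubmatrix S C)) :=
    ((continuous_id.matrix_submatrix _ _).tendsto C).comp hA
  have hmul : Continuous fun D : Matrix S S ℝ => D * selectionMatrix S :=
    continuous_id.matrix_mul continuous_const
  exact (hmul.tendsto _).comp ((continuousAt_matrix_inv _ hinv).tendsto.comp hsub)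

lemma tendsto_dualMatrix {A : α → Matrix (Fin p) (Fin p) ℝ} {C : Matrix (Fin p) (Fin p) ℝ}
    (hC : C.PosDef) (hA : Tendsto A l (𝓝 C)) (S : Finset (Fin p)) :
    Tendsto (fun a => dualMatrix S (A a)) l (𝓝 (dualMatrix S C)) := by
  have hmul : Continuous fun q : Matrix (Fin p) (Fin p) ℝ × Matrix S (Fin p) ℝ =>
      q.1 * (selectionMatrix S)ᵀ * q.2 :=
    (continuous_fst.matrix_mul continuous_const).matrix_mul continuous_snd
  have hprod := (hmul.tendsto (C, oracleMatrix S C)).comp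
    (hA.prodMk_nhds (tendsto_oracleMatrix hC hA S))
  simp only [dualMatrix]
  exact tendsto_const_nhds.sub hprod

lemma eventually_posDef_empiricalGram {X : (n : ℕ) → Matrix (Fin n) (Fin p) ℝ}
    {C : Matrix (Fin p) (Fin p) ℝ} (hC : C.PosDef)
    (hX : Tendsto (fun n => empiricalGram (X n)) atTop (𝓝 C)) :
    ∀ᶠ n in atTop, (empiricalGram (X n)).PosDef := by
  have hdet := ((continuous_id.matrix_det).tendsto C).comp hX
  filter_upwards [hdet.eventually_ne hC.det_pos.ne'] with n hn
  exact (posSemidef_empiricalGram (X n)).posDef_iff_det_ne_zero.2 hn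

lemma tendsto_penaltyShift {lam eta : ℕ → ℝ}
    (hsub : Tendsto (fun n : ℕ => (lam n - eta n) / √(n : ℝ)) atTop (𝓝 0))
    (β : EuclideanSpace ℝ (Fin p)) :
    Tendsto (fun n => penaltyShift n (lam n) (eta n) β) atTop (𝓝 0) := by
  refine ((PiLp.continuous_toLp 2 _).tendsto 0).comp (tendsto_pi_nhds.2 fun j => ?_)
  simpa using (hsub.div_const 2).mul_const ((SignType.sign (β j) : SignType) : ℝ)

lemma eventually_nonneg_of_tendsto_add_of_tendsto_sub {lam eta : ℕ → ℝ}
    (hadd : Tendsto (fun n : ℕ => (lam n + eta n) / √(n : ℝ)) atTop atTop)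
    (hsub : Tendsto (fun n : ℕ => (lam n - eta n) / √(n : ℝ)) atTop (𝓝 0)) :
    ∀ᶠ n in atTop, 0 ≤ lam n ∧ 0 ≤ eta n := by
  filter_upwards [eventually_gt_atTop 0, hadd.eventually_ge_atTop 1,
    hsub.eventually (Icc_mem_nhds (show (-1 : ℝ) < 0 by simp) one_pos)] with n hn hs hd
  have hsqrt : 0 < √(n : ℝ) := by positivity
  have h1 := (le_div_iff₀ hsqrt).1 hs
  have h2 := (div_le_iff₀ hsqrt).1 hd.2
  have h3 := (le_div_iff₀ hsqrt).1 hd.1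
  constructor <;> linarith

lemma tendsto_toLp_mulVec_zero {κ : Type*} {B : α → Matrix κ (Fin p) ℝ} {B₀ : Matrix κ (Fin p) ℝ}
    {v : α → EuclideanSpace ℝ (Fin p)} (hB : Tendsto B l (𝓝 B₀)) (hv : Tendsto v l (𝓝 0)) :
    Tendsto (fun a => WithLp.toLp 2 (B a *ᵥ v a)) l (𝓝 (0 : EuclideanSpace ℝ κ)) := by
  have hcont : Continuous fun q : Matrix κ (Fin p) ℝ × EuclideanSpace ℝ (Fin p) =>
      WithLp.toLp 2 (q.1 *ᵥ q.2) := by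
    fun_prop
  simpa [Function.comp_def] using (hcont.tendsto (B₀, 0)).comp (hB.prodMk_nhds hv)

variable {X : (n : ℕ) → Matrix (Fin n) (Fin p) ℝ} {C : Matrix (Fin p) (Fin p) ℝ}
  {Ω : ℕ → Type*} [∀ n, MeasurableSpace (Ω n)] {P : (n : ℕ) → Measure (Ω n)}
  [∀ n, IsProbabilityMeasure (P n)] {σ : ℝ≥0} {ε : (n : ℕ) → Ω n → EuclideanSpace ℝ (Fin n)}

lemma tendstoInDistribution_add_mulVec_score {κ : Type*} [Fintype κ] [DecidableEq κ]
    (hC : C.PosSemidef) (hX : Tendsto (fun n => empiricalGram (X n)) atTop (𝓝 C))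
    (hε_law : ∀ n (i : Fin n), HasLaw (fun ω => ε n ω i) (gaussianReal 0 (σ ^ 2)) (P n))
    (hε_indep : ∀ n, iIndepFun (fun (i : Fin n) ω => ε n ω i) (P n))
    {m : ℕ → EuclideanSpace ℝ κ} {m₀ : EuclideanSpace ℝ κ} (hm : Tendsto m atTop (𝓝 m₀))
    {B : ℕ → Matrix κ (Fin p) ℝ} {B₀ : Matrix κ (Fin p) ℝ} (hB : Tendsto B atTop (𝓝 B₀)) :
    TendstoInDistribution (fun n ω => m n + WithLp.toLp 2 (B n *ᵥ score (X n) (ε n ω))) atTop id P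
      (multivariateGaussian m₀ ((σ : ℝ) ^ 2 • (B₀ * C * B₀ᵀ))) := by
  have hlaw (n : ℕ) : HasLaw (fun ω => m n + WithLp.toLp 2 (B n *ᵥ score (X n) (ε n ω)))
      (multivariateGaussian (m n) ((σ : ℝ) ^ 2 • (B n * empiricalGram (X n) * (B n)ᵀ))) (P n) := by
    have hT : ((√(n : ℝ))⁻¹ • (B n * (X n)ᵀ)) * ((√(n : ℝ))⁻¹ • (B n * (X n)ᵀ))ᵀ
        = B n * empiricalGram (X n) * (B n)ᵀ := by
      have hsq : (√(n : ℝ))⁻¹ * (√(n : ℝ))⁻¹ = (n : ℝ)⁻¹ := by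
        rw [← mul_inv, Real.mul_self_sqrt n.cast_nonneg]
      simp [empiricalGram, smul_smul, hsq, Matrix.mul_assoc]
    have h := hasLaw_multivariateGaussian_add_mulVec (hε_law n) (hε_indep n) (m n)
      ((√(n : ℝ))⁻¹ • (B n * (X n)ᵀ))
    rw [hT] at h
    simpa [score, Matrix.smul_mulVec, Matrix.mulVec_smul, NNReal.smul_def] using h
  have hcov {M : Matrix (Fin p) (Fin p) ℝ} (hM : M.PosSemidef) (A : Matrix κ (Fin p) ℝ) :
      ((σ : ℝ) ^ 2 • (A * M * Aᵀ)).PosSemidef :=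
    (hM.mul_mul_conjTranspose_same A).smul (sq_nonneg (σ : ℝ))
  have hcont : Continuous fun q : Matrix κ (Fin p) ℝ × Matrix (Fin p) (Fin p) ℝ =>
      q.1 * q.2 * q.1ᵀ :=
    (continuous_fst.matrix_mul continuous_snd).matrix_mul continuous_fst.matrix_transpose
  refine ⟨fun n => (hlaw n).aemeasurable, aemeasurable_id, ?_⟩
  simp only [(hlaw _).map_eq, Measure.map_id]
  exact tendsto_multivariateGaussian (fun n => hcov (posSemidef_empiricalGram (X n)) (B n))
    (hcov hC B₀) hm (((hcont.tendsto (B₀, C)).comp (hB.prodMk_nhds hX)).const_smul _)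

lemma tendstoInDistribution_oracleError (hC : C.PosDef)
    (hX : Tendsto (fun n => empiricalGram (X n)) atTop (𝓝 C))
    (hε_law : ∀ n (i : Fin n), HasLaw (fun ω => ε n ω i) (gaussianReal 0 (σ ^ 2)) (P n))
    (hε_indep : ∀ n, iIndepFun (fun (i : Fin n) ω => ε n ω i) (P n))
    {τ : ℕ → EuclideanSpace ℝ (Fin p)} (hτ : Tendsto τ atTop (𝓝 0)) (S : Finset (Fin p)) :
    TendstoInDistribution (fun n ω => oracleError (X n) S (τ n) (ε n ω)) atTop id P
      (multivariateGaussian 0 ((σ : ℝ) ^ 2 • (principalSubmatrix S C)⁻¹)) := by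
  have hB := tendsto_oracleMatrix hC hX S
  have hm := (tendsto_toLp_mulVec_zero hB hτ).neg
  simpa only [oracleError_eq_add_mulVec_score, neg_zero, oracleMatrix_mul_mul_transpose hC]
    using tendstoInDistribution_add_mulVec_score hC.posSemidef hX hε_law hε_indep hm hB

lemma tendstoInDistribution_oracleDual (hC : C.PosDef)
    (hX : Tendsto (fun n => empiricalGram (X n)) atTop (𝓝 C))
    (hε_law : ∀ n (i : Fin n), HasLaw (fun ω => ε n ω i) (gaussianReal 0 (σ ^ 2)) (P n))
    (hε_indep : ∀ n, iIndepFun (fun (i : Fin n) ω => ε n ω i) (P n))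
    {τ : ℕ → EuclideanSpace ℝ (Fin p)} (hτ : Tendsto τ atTop (𝓝 0)) (S : Finset (Fin p)) :
    TendstoInDistribution (fun n ω => oracleDual (X n) S (τ n) (ε n ω)) atTop id P
      (multivariateGaussian 0 ((σ : ℝ) ^ 2 • (dualMatrix S C * C * (dualMatrix S C)ᵀ))) := by
  have hB := tendsto_dualMatrix hC hX S
  have hm := tendsto_toLp_mulVec_zero ((tendsto_const_nhds (x := 1)).sub hB) hτ
  simpa only [oracleDual_eq_add_mulVec_score]
    using tendstoInDistribution_add_mulVec_score hC.posSemidef hX hε_law hε_indep hm hB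

variable {βstar βtilde : EuclideanSpace ℝ (Fin p)} {lam eta : ℕ → ℝ}
  {βhat : (n : ℕ) → Ω n → EuclideanSpace ℝ (Fin p)}

lemma tendsto_measure_not_oracle_property (hC : C.PosDef)
    (hX : Tendsto (fun n => empiricalGram (X n)) atTop (𝓝 C))
    (hε_law : ∀ n (i : Fin n), HasLaw (fun ω => ε n ω i) (gaussianReal 0 (σ ^ 2)) (P n))
    (hε_indep : ∀ n, iIndepFun (fun (i : Fin n) ω => ε n ω i) (P n))
    (hST : activeSet βstar = changeSet βtilde βstar)
    (hsign : ∀ j ∈ activeSet βstar,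
      SignType.sign (βtilde j - βstar j) = SignType.sign (βstar j))
    (hadd : Tendsto (fun n : ℕ => (lam n + eta n) / √(n : ℝ)) atTop atTop)
    (hsub : Tendsto (fun n : ℕ => (lam n - eta n) / √(n : ℝ)) atTop (𝓝 0))
    (hβhat : ∀ n, ∀ᵐ ω ∂(P n),
      IsTransferLasso (X n) (linearResponse (X n) βstar (ε n ω)) βtilde (lam n) (eta n)
        (βhat n ω)) :
    Tendsto (fun n => P n {ω | ¬(activeSet (βhat n ω) = activeSet βstar ∧
      changeSet βtilde (βhat n ω) = changeSet βtilde βstar ∧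
      √(n : ℝ) • restrictTo (activeSet βstar) (βhat n ω - βstar) = oracleError (X n)
        (activeSet βstar) (penaltyShift n (lam n) (eta n) βstar) (ε n ω))}) atTop (𝓝 0) := by
  set S := activeSet βstar
  obtain ⟨δ, hδ, hδS⟩ := exists_pos_le_abs_of_mem_activeSet hST
  have hτ := tendsto_penaltyShift hsub βstar
  have hsqrt : Tendsto (fun n : ℕ => √(n : ℝ) * δ) atTop atTop :=
    (Real.tendsto_sqrt_atTop.comp tendsto_natCast_atTop_atTop).atTop_mul_const hδ
  have hlarge := (tendsto_measure_norm_ge_of_tendstoInDistribution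
      (tendstoInDistribution_oracleError hC hX hε_law hε_indep hτ S) hsqrt).add
    (tendsto_measure_norm_ge_of_tendstoInDistribution
      (tendstoInDistribution_oracleDual hC hX hε_law hε_indep hτ S) (hadd.atTop_div_const two_pos))
  rw [add_zero] at hlarge
  refine tendsto_of_tendsto_of_tendsto_of_le_of_le' tendsto_const_nhds hlarge
    (.of_forall fun _ => zero_le) ?_
  filter_upwards [eventually_gt_atTop 0, eventually_posDef_empiricalGram hC hX,
    eventually_nonneg_of_tendsto_add_of_tendsto_sub hadd hsub] with n hn hgram hnonneg
  refine (measure_mono_ae ?_).trans (measure_union_le _ _)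
  filter_upwards [hβhat n] with ω hω hbad
  by_contra hsmall
  obtain ⟨herror, hdual⟩ := not_or.1 hsmall
  exact hbad (hω.oracle_property hn hgram hnonneg.1 hnonneg.2
    (fun j => eq_zero_and_eq_zero_of_notMem_activeSet hST) hsign hδS (not_le.1 herror)
    (not_le.1 hdual))

end Limits

theorem mainTheorem12_general {p : ℕ}
    (X : (n : ℕ) → Matrix (Fin n) (Fin p) ℝ) (C : Matrix (Fin p) (Fin p) ℝ)
    (hC : C.PosDef)
    (hX : Tendsto (fun n : ℕ => (1 / (n : ℝ)) • ((X n)ᵀ * X n)) atTop (𝓝 C))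
    {Ω : ℕ → Type*} [∀ n, MeasurableSpace (Ω n)]
    (P : (n : ℕ) → Measure (Ω n)) [∀ n, IsProbabilityMeasure (P n)]
    (σ : ℝ≥0) (ε : (n : ℕ) → Ω n → EuclideanSpace ℝ (Fin n))
    (hε_law : ∀ n (i : Fin n), HasLaw (fun ω => ε n ω i) (gaussianReal 0 (σ ^ 2)) (P n))
    (hε_indep : ∀ n, iIndepFun (fun (i : Fin n) ω => ε n ω i) (P n))
    (βstar βtilde : EuclideanSpace ℝ (Fin p))
    (hST : activeSet βstar = changeSet βtilde βstar)
    (hsign : ∀ j ∈ activeSet βstar,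
      SignType.sign (βtilde j - βstar j) = SignType.sign (βstar j))
    (lam eta : ℕ → ℝ)
    (hadd : Tendsto (fun n : ℕ => (lam n + eta n) / √(n : ℝ)) atTop atTop)
    (hsub : Tendsto (fun n : ℕ => (lam n - eta n) / √(n : ℝ)) atTop (𝓝 0))
    (βhat : (n : ℕ) → Ω n → EuclideanSpace ℝ (Fin p))
    (hβhat_meas : ∀ n, AEMeasurable (βhat n) (P n))
    (hβhat : ∀ n, ∀ᵐ ω ∂(P n),
      IsTransferLasso (X n) (linearResponse (X n) βstar (ε n ω)) βtilde (lam n) (eta n)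
        (βhat n ω)) :
    Tendsto (fun n => P n {ω | activeSet (βhat n ω) = activeSet βstar}) atTop (𝓝 1) ∧
    Tendsto (fun n => P n {ω | changeSet βtilde (βhat n ω) = changeSet βtilde βstar})
      atTop (𝓝 1) ∧
    TendstoInDistribution
      (fun (n : ℕ) ω => √(n : ℝ) • restrictTo (activeSet βstar) (βhat n ω - βstar)) atTop
      (id : EuclideanSpace ℝ (activeSet βstar) → EuclideanSpace ℝ (activeSet βstar)) P
      (multivariateGaussian 0
        ((σ : ℝ) ^ 2 • (principalSubmatrix (activeSet βstar) C)⁻¹)) := by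
  have hgood :=
    tendsto_measure_not_oracle_property hC hX hε_law hε_indep hST hsign hadd hsub hβhat
  have herror := tendstoInDistribution_oracleError hC hX hε_law hε_indep
    (tendsto_penaltyShift hsub βstar) (activeSet βstar)
  refine ⟨tendsto_measure_one_of_tendsto_measure_compl_zero
      (tendsto_measure_not_zero_mono hgood fun _ _ h => h.1),
    tendsto_measure_one_of_tendsto_measure_compl_zero
      (tendsto_measure_not_zero_mono hgood fun _ _ h => h.2.1),
    tendstoInDistribution_of_tendsto_measure_ne herror (fun n => ?_)
      (tendsto_measure_not_zero_mono hgood fun _ _ h => h.2.2)⟩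
  unfold restrictTo
  fun_prop

theorem mainTheorem12 {p : ℕ}
    -- design matrices, one for each sample size
    (X : (n : ℕ) → Matrix (Fin n) (Fin p) ℝ) (C : Matrix (Fin p) (Fin p) ℝ)
    (hC : C.PosDef)
    (hX : Tendsto (fun n : ℕ => (1 / (n : ℝ)) • ((X n)ᵀ * X n)) atTop (𝓝 C))
    (hXmax : Tendsto
      (fun n : ℕ => 1 / (n : ℝ) * ⨆ i : Fin n, ‖WithLp.toLp 2 (X n i)‖ ^ 2) atTop (𝓝 0))
    -- i.i.d. Gaussian noise with variance `σ ^ 2`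
    {Ω : ℕ → Type*} [∀ n, MeasurableSpace (Ω n)]
    (P : (n : ℕ) → Measure (Ω n)) [∀ n, IsProbabilityMeasure (P n)]
    (σ : ℝ≥0) (ε : (n : ℕ) → Ω n → EuclideanSpace ℝ (Fin n))
    (hε_law : ∀ n (i : Fin n), HasLaw (fun ω => ε n ω i) (gaussianReal 0 (σ ^ 2)) (P n))
    (hε_indep : ∀ n, iIndepFun (fun (i : Fin n) ω => ε n ω i) (P n))
    -- true parameter, deterministic source parameter, and the conditions on them
    (βstar βtilde : EuclideanSpace ℝ (Fin p))
    (hST : activeSet βstar = changeSet βtilde βstar)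
    (hsign : ∀ j ∈ activeSet βstar,
      SignType.sign (βtilde j - βstar j) = SignType.sign (βstar j))
    -- regularization parameters
    (lam eta : ℕ → ℝ)
    (hadd : Tendsto (fun n : ℕ => (lam n + eta n) / √(n : ℝ)) atTop atTop)
    (hsub : Tendsto (fun n : ℕ => (lam n - eta n) / √(n : ℝ)) atTop (𝓝 0))
    -- the Transfer Lasso estimator
    (βhat : (n : ℕ) → Ω n → EuclideanSpace ℝ (Fin p))
    (hβhat_meas : ∀ n, AEMeasurable (βhat n) (P n))
    (hβhat : ∀ n, ∀ᵐ ω ∂(P n),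
      IsTransferLasso (X n) (linearResponse (X n) βstar (ε n ω)) βtilde (lam n) (eta n)
        (βhat n ω)) :
    Tendsto (fun n => P n {ω | activeSet (βhat n ω) = activeSet βstar}) atTop (𝓝 1) ∧
    Tendsto (fun n => P n {ω | changeSet βtilde (βhat n ω) = changeSet βtilde βstar})
      atTop (𝓝 1) ∧
    TendstoInDistribution
      (fun (n : ℕ) ω => √(n : ℝ) • restrictTo (activeSet βstar) (βhat n ω - βstar)) atTop
      (id : EuclideanSpace ℝ (activeSet βstar) → EuclideanSpace ℝ (activeSet βstar)) P
      (multivariateGaussian 0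
        ((σ : ℝ) ^ 2 • (principalSubmatrix (activeSet βstar) C)⁻¹)) :=
  mainTheorem12_general X C hC hX P σ ε hε_law hε_indep βstar βtilde hST hsign lam eta hadd hsub
    βhat hβhat_meas hβhat
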